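/- Let $n,m\in\mathbb N$ and let $g_0=\sum_i\epsilon_i\,dx_i^2$ on $\mathbb R^n$ and $\tilde g_0=\sum_j\delta_j\,dy_j^2$ on $\mathbb R^m$ be semi-Euclidean metrics, $\epsilon_i,\delta_j\in\{1,-1\}$. Let $\alpha\in\mathbb R^n$ and $\beta\in\mathbb R^m$ be non-zero vectors, and put $\xi(x)=\sum_i\alpha_ix_i$, $\zeta(y)=\sum_j\beta_jy_j$ and $\|\alpha\|^2=\sum_i\epsilon_i\alpha_i^2$. Let $I,J\subseteq\mathbb R$ be non-empty open intervals (for instance $I=J=\mathbb R$), and let $\varphi,f,h:I\to\mathbb R$ and $\tau,u:J\to\mathbb R$ be smooth functions such that $\varphi$ and $\tau$ vanish nowhere, $f>0$, and $u$ is not constant. On the open set $M=\{(x,y)\in\mathbb R^n\times\mathbb R^m:\ \xi(x)\in I,\ \zeta(y)\in J\}$ (all of $\mathbb R^n\times\mathbb R^m$ if $I=J=\mathbb R$) consider the warped product metric $$g=\varphi(\xi)^{-2}g_0+f(\xi)^2\,\tau(\zeta)^{-2}\tilde g_0 .$$ Suppose that, for some $\lambda\in\mathbb R$, $(M,g)$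 is a gradient Ricci-harmonic soliton (GRHS) with potential function $h=h(\xi)$ and harmonic map $u=u(\zeta):M\to\mathbb R$, that is, there is a constant $\theta\ge 0$ such that on $M$ $$\mathrm{Ric}_g+\mathrm{Hess}_g h-\theta\,du\otimes du=\lambda g,\qquad \tau_g u-g(\nabla u,\nabla h)=0,$$ where $\tau_gu=\mathrm{trace}_g(\nabla du)$ is the tension field of $u$. If $\|\alpha\|^2=0$, then the soliton is steady, i.e. $\lambda=0$. -/

import Mathlib

open scoped ContDiff

noncomputable section

namespace GRHS

/-! ## Semi-Riemannian geometry in global coordinates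

Points are `x : ι → ℝ`, and a field of bilinear forms on an open set `U` of `ι → ℝ` is given by
its matrix of components `G x i j = g(∂ᵢ, ∂ⱼ)` at `x`. -/

section Coordinates

variable {ι : Type*} [Fintype ι] [DecidableEq ι]

/-- The partial derivative `∂ᵢ F` at `x`. -/
def pd (i : ι) (F : (ι → ℝ) → ℝ) (x : ι → ℝ) : ℝ :=
  fderiv ℝ F x (Pi.single i 1)

/-- `G` is a (smooth) semi-Riemannian metric on the set `U`, of any signature. -/
structure IsSemiRiemannianMetricOn (U : Set (ι → ℝ)) (G : (ι → ℝ) → Matrix ι ι ℝ) : Prop where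
  smooth : ∀ i j, ContDiffOn ℝ ∞ (fun x => G x i j) U
  symm : ∀ x ∈ U, (G x).IsSymm
  nondegenerate : ∀ x ∈ U, (G x).det ≠ 0

/-- The Christoffel symbol `Γᵏᵢⱼ` of the Levi-Civita connection of `G`. -/
def christoffel (G : (ι → ℝ) → Matrix ι ι ℝ) (k i j : ι) (x : ι → ℝ) : ℝ :=
  (1 / 2 : ℝ) * ∑ l, (G x)⁻¹ k l *
    (pd i (fun y => G y j l) x + pd j (fun y => G y i l) x - pd l (fun y => G y i j) x)

/-- The component `Ricᵢⱼ` of the Ricci tensor of `G` (positive on round spheres). -/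
def ricci (G : (ι → ℝ) → Matrix ι ι ℝ) (i j : ι) (x : ι → ℝ) : ℝ :=
  ∑ k, (pd k (christoffel G k i j) x - pd j (christoffel G k i k) x
    + ∑ l, (christoffel G k k l x * christoffel G l i j x
      - christoffel G k j l x * christoffel G l i k x))

/-- The component `(Hess F)ᵢⱼ = (∇dF)ᵢⱼ` of the Hessian of a function with respect to `G`. -/
def hess (G : (ι → ℝ) → Matrix ι ι ℝ) (F : (ι → ℝ) → ℝ) (i j : ι) (x : ι → ℝ) : ℝ :=
  pd i (pd j F) x - ∑ k, christoffel G k i j x * pd k F x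

/-- The tension field of a real function (target `(ℝ, dr²)`): the trace of `∇dF` under `G`. -/
def tension (G : (ι → ℝ) → Matrix ι ι ℝ) (F : (ι → ℝ) → ℝ) (x : ι → ℝ) : ℝ :=
  ∑ i, ∑ j, (G x)⁻¹ i j * hess G F i j x

/-- The function `g(∇F, ∇H)`. -/
def gradInner (G : (ι → ℝ) → Matrix ι ι ℝ) (F H : (ι → ℝ) → ℝ) (x : ι → ℝ) : ℝ :=
  ∑ i, ∑ j, (G x)⁻¹ i j * pd i F x * pd j H x

/-- `(U, G)` with potential function `h`, real-valued map `u` and constant `lam` is a gradient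
Ricci-harmonic soliton: for some constant `θ ≥ 0`, on `U`,
`Ric + Hess h - θ du ⊗ du = lam g` and `τ u - g(∇u, ∇h) = 0`. -/
structure IsGRHSOn (U : Set (ι → ℝ)) (G : (ι → ℝ) → Matrix ι ι ℝ) (h u : (ι → ℝ) → ℝ)
    (lam : ℝ) : Prop where
  isOpen : IsOpen U
  metric : IsSemiRiemannianMetricOn U G
  smooth_potential : ContDiffOn ℝ ∞ h U
  smooth_map : ContDiffOn ℝ ∞ u U
  equations : ∃ θ : ℝ, 0 ≤ θ ∧ ∀ x ∈ U,
    (∀ i j, ricci G i j x + hess G h i j x - θ * (pd i u x * pd j u x) = lam * G x i j) ∧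
    tension G u x - gradInner G u h x = 0

/-- The semi-Euclidean metric `(g₀)ᵢⱼ = εᵢ δᵢⱼ`. -/
def semiEuclidean (ε : ι → ℝ) : (ι → ℝ) → Matrix ι ι ℝ :=
  fun _ => Matrix.diagonal ε

/-- The conformal metric `ψ⁻² G`. -/
def conformal (ψ : (ι → ℝ) → ℝ) (G : (ι → ℝ) → Matrix ι ι ℝ) : (ι → ℝ) → Matrix ι ι ℝ :=
  fun x => ((ψ x) ^ 2)⁻¹ • G x

/-- The square `‖α‖² = ∑ᵢ εᵢ αᵢ²` in the semi-Euclidean metric with signs `ε`. -/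
def semiNormSq (ε α : ι → ℝ) : ℝ :=
  ∑ i, ε i * α i ^ 2

end Coordinates

/-- The projection of `ℝⁿ × ℝᵐ`, with coordinates indexed by `Fin n ⊕ Fin m`, to the base. -/
def toBase {n m : ℕ} (p : Fin n ⊕ Fin m → ℝ) : Fin n → ℝ := fun i => p (Sum.inl i)

/-- The projection of `ℝⁿ × ℝᵐ` to the fiber. -/
def toFiber {n m : ℕ} (p : Fin n ⊕ Fin m → ℝ) : Fin m → ℝ := fun i => p (Sum.inr i)

/-- The warped product metric `π^* gB + (f ∘ π)² σ^* gF`. -/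
def warped {n m : ℕ} (gB : (Fin n → ℝ) → Matrix (Fin n) (Fin n) ℝ) (f : (Fin n → ℝ) → ℝ)
    (gF : (Fin m → ℝ) → Matrix (Fin m) (Fin m) ℝ) :
    (Fin n ⊕ Fin m → ℝ) → Matrix (Fin n ⊕ Fin m) (Fin n ⊕ Fin m) ℝ :=
  fun p => Matrix.fromBlocks (gB (toBase p)) 0 0 ((f (toBase p)) ^ 2 • gF (toFiber p))

end GRHS

end

open scoped ContDiff
open Filter Topology

noncomputable section

namespace GRHS

/-! Write the soliton equation on base directions. The term `θ du ⊗ du` vanishes there, since `u`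
depends on the fiber only. The base Christoffel symbols are a logarithmic derivative of `φ` times
the constant symbol `T` below, and every contraction of `T` entering Ricci or the Hessian is a
multiple of `αᵢαⱼ`, up to Kronecker terms carrying the factor `‖α‖² = 0`. So `Ric + Hess h` is `S
αᵢαⱼ` on the base (`ricci_inl_inl_of_null`, `hess_inl_inl_of_null`).

The equation becomes `S αᵢαⱼ = λ φ⁻² εᵢδᵢⱼ`. Contracting with `εⱼαⱼ`, the `g₀`-dual of `α`, turns
the left side into `S αᵢ‖α‖² = 0` and the right side into `λ φ⁻² αᵢ`; choosing `αᵢ ≠ 0` gives `λ =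
0`. One point of `M` suffices. -/

variable {n m : ℕ}

/-! ### Algebra of the conformal symbol for a null covector -/

/-- The symbol `Tᵏᵢⱼ = δⱼₖ αᵢ + δᵢₖ αⱼ - δᵢⱼ εᵢ εₖ αₖ`: the Christoffel symbols of a metric
conformal to the semi-Euclidean one, with factor depending on `α ⬝ᵥ x`, are multiples of it. -/
def conformalSymbol (ε α : Fin n → ℝ) (k i j : Fin n) : ℝ :=
  (if j = k then α i else 0) + (if i = k then α j else 0) - (if i = j then ε i * ε k * α k else 0)

lemma conformalSymbol_symm (ε α : Fin n → ℝ) (k i j : Fin n) :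
    conformalSymbol ε α k i j = conformalSymbol ε α k j i := by
  unfold conformalSymbol
  by_cases h : i = j
  · subst h; rfl
  · simp [h, Ne.symm h, add_comm]

/-- The first two Kronecker terms each contribute `αᵢαⱼ`; the third contributes a multiple of
`‖α‖²`. -/
lemma sum_conformalSymbol_mul {ε α : Fin n → ℝ} (hnull : semiNormSq ε α = 0) (i j : Fin n) :
    ∑ k, conformalSymbol ε α k i j * α k = 2 * (α i * α j) := by
  have h : ∑ k, (if i = j then ε i * ε k * α k else 0) * α k
      = (if i = j then ε i else 0) * semiNormSq ε α := by
    rw [semiNormSq, Finset.mul_sum]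
    refine Finset.sum_congr rfl fun k _ => ?_
    split_ifs <;> ring
  simp only [conformalSymbol, sub_mul, add_mul, Finset.sum_sub_distrib, Finset.sum_add_distrib]
  rw [h, hnull]
  simp [ite_mul]
  ring

lemma sum_conformalSymbol_trace {ε : Fin n → ℝ} (hε : ∀ i, ε i * ε i = 1) (α : Fin n → ℝ)
    (i : Fin n) : ∑ k, conformalSymbol ε α k i k = n * α i := by
  simp [conformalSymbol, Finset.sum_sub_distrib, Finset.sum_add_distrib, hε]

lemma sum_conformalSymbol_mul_conformalSymbol {ε α : Fin n → ℝ} (hε : ∀ i, ε i * ε i = 1)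
    (hnull : semiNormSq ε α = 0) (i j : Fin n) :
    ∑ k, ∑ l, conformalSymbol ε α k j l * conformalSymbol ε α l i k
      = (n + 2) * (α i * α j) := by
  -- Only the first factor is expanded: its Kronecker deltas collapse the sum over `l`, or leave a
  -- contraction with `α` already known.
  have key : ∀ k, ∑ l, conformalSymbol ε α k j l * conformalSymbol ε α l i k
      = α j * conformalSymbol ε α k i k + (if j = k then 2 * (α i * α k) else 0)
        - ε j * ε k * α k * conformalSymbol ε α j i k := by
    intro k
    have h := sum_conformalSymbol_mul hnull i k
    have : ∀ l, conformalSymbol ε α k j l * conformalSymbol ε α l i k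
        = (if l = k then α j * conformalSymbol ε α l i k else 0)
          + (if j = k then conformalSymbol ε α l i k * α l else 0)
          - (if j = l then ε j * ε k * α k * conformalSymbol ε α l i k else 0) := by
      intro l
      conv_lhs => enter [1]; unfold conformalSymbol
      split_ifs <;> ring
    simp only [this, Finset.sum_sub_distrib, Finset.sum_add_distrib]
    by_cases hjk : j = k <;> simp [hjk, h]
  simp only [key, Finset.sum_sub_distrib, Finset.sum_add_distrib, ← Finset.mul_sum,
    sum_conformalSymbol_trace hε]
  -- The first and last Kronecker terms give `αᵢαⱼ` with opposite signs; the middle one carries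
  -- `‖α‖²`.
  have h2 : ∑ k, ε j * ε k * α k * conformalSymbol ε α j i k = 0 := by
    have : ∀ k, ε j * ε k * α k * conformalSymbol ε α j i k
        = (if k = j then ε j * ε k * α k * α i else 0)
          + (if i = j then ε j * (ε k * α k ^ 2) else 0)
          - (if i = k then (ε j * ε j) * (ε k * ε k) * α k * α j else 0) := by
      intro k
      unfold conformalSymbol
      by_cases h1 : i = k
      · subst h1; split_ifs <;> ring
      · split_ifs <;> ring
    have hs : ∑ k, ε k * α k ^ 2 = 0 := hnull
    simp only [this, Finset.sum_sub_distrib, Finset.sum_add_distrib]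
    by_cases hij : i = j <;> simp [hij, hε, ← Finset.mul_sum, hs]; ring
  rw [h2]
  simp
  ring

/-! ### Partial derivatives of functions of `ξ` and `ζ` -/

/-- The linear form `p ↦ α ⬝ᵥ toBase p`. -/
def baseForm (m : ℕ) (α : Fin n → ℝ) : (Fin n ⊕ Fin m → ℝ) →L[ℝ] ℝ :=
  ∑ i, α i • ContinuousLinearMap.proj (Sum.inl i)

/-- The linear form `p ↦ β ⬝ᵥ toFiber p`. -/
def fiberForm (n : ℕ) (β : Fin m → ℝ) : (Fin n ⊕ Fin m → ℝ) →L[ℝ] ℝ :=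
  ∑ j, β j • ContinuousLinearMap.proj (Sum.inr j)

lemma baseForm_apply (α : Fin n → ℝ) (p : Fin n ⊕ Fin m → ℝ) :
    baseForm m α p = α ⬝ᵥ toBase p := by
  simp [baseForm, toBase, dotProduct]

lemma fiberForm_apply (β : Fin m → ℝ) (p : Fin n ⊕ Fin m → ℝ) :
    fiberForm n β p = β ⬝ᵥ toFiber p := by
  simp [fiberForm, toFiber, dotProduct]

lemma baseForm_single_inl (α : Fin n → ℝ) (i : Fin n) :
    baseForm m α (Pi.single (Sum.inl i) 1) = α i := by
  simp [baseForm, Pi.single_apply]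

lemma baseForm_single_inr (α : Fin n → ℝ) (j : Fin m) :
    baseForm m α (Pi.single (Sum.inr j) 1) = 0 := by
  simp [baseForm]

lemma fiberForm_single_inl (β : Fin m → ℝ) (i : Fin n) :
    fiberForm n β (Pi.single (Sum.inl i) 1) = 0 := by
  simp [fiberForm]

lemma hasFDerivAt_comp_base {α : Fin n → ℝ} {A : ℝ → ℝ} {A' : ℝ} {p : Fin n ⊕ Fin m → ℝ}
    (hA : HasDerivAt A A' (α ⬝ᵥ toBase p)) :
    HasFDerivAt (fun q => A (α ⬝ᵥ toBase q)) (A' • baseForm m α) p := by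
  simp only [← baseForm_apply] at hA ⊢
  exact hA.comp_hasFDerivAt p (baseForm m α).hasFDerivAt

lemma hasFDerivAt_comp_fiber {β : Fin m → ℝ} {B : ℝ → ℝ} {B' : ℝ} {p : Fin n ⊕ Fin m → ℝ}
    (hB : HasDerivAt B B' (β ⬝ᵥ toFiber p)) :
    HasFDerivAt (fun q => B (β ⬝ᵥ toFiber q)) (B' • fiberForm n β) p := by
  simp only [← fiberForm_apply] at hB ⊢
  exact hB.comp_hasFDerivAt p (fiberForm n β).hasFDerivAt

lemma pd_inl_comp_base_mul {α : Fin n → ℝ} {A : ℝ → ℝ} {A' : ℝ} {p : Fin n ⊕ Fin m → ℝ}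
    (hA : HasDerivAt A A' (α ⬝ᵥ toBase p)) (c : ℝ) (i : Fin n) :
    pd (Sum.inl i) (fun q => A (α ⬝ᵥ toBase q) * c) p = A' * α i * c := by
  rw [pd, ((hasFDerivAt_comp_base hA).mul_const c).fderiv]
  simp [baseForm_single_inl]
  ring

lemma pd_inr_comp_base_mul {α : Fin n → ℝ} {A : ℝ → ℝ} {A' : ℝ} {p : Fin n ⊕ Fin m → ℝ}
    (hA : HasDerivAt A A' (α ⬝ᵥ toBase p)) (c : ℝ) (j : Fin m) :
    pd (Sum.inr j) (fun q => A (α ⬝ᵥ toBase q) * c) p = 0 := by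
  rw [pd, ((hasFDerivAt_comp_base hA).mul_const c).fderiv]
  simp [baseForm_single_inr]

lemma pd_inl_comp_base_mul_comp_fiber {α : Fin n → ℝ} {β : Fin m → ℝ} {A B : ℝ → ℝ} {A' B' : ℝ}
    {p : Fin n ⊕ Fin m → ℝ} (hA : HasDerivAt A A' (α ⬝ᵥ toBase p))
    (hB : HasDerivAt B B' (β ⬝ᵥ toFiber p)) (i : Fin n) :
    pd (Sum.inl i) (fun q => A (α ⬝ᵥ toBase q) * B (β ⬝ᵥ toFiber q)) p
      = A' * α i * B (β ⬝ᵥ toFiber p) := by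
  rw [pd, ((hasFDerivAt_comp_base hA).fun_mul (hasFDerivAt_comp_fiber hB)).fderiv]
  simp [baseForm_single_inl, fiberForm_single_inl]
  ring

lemma pd_inl_comp_fiber {β : Fin m → ℝ} {B : ℝ → ℝ} {B' : ℝ} {p : Fin n ⊕ Fin m → ℝ}
    (hB : HasDerivAt B B' (β ⬝ᵥ toFiber p)) (i : Fin n) :
    pd (Sum.inl i) (fun q => B (β ⬝ᵥ toFiber q)) p = 0 := by
  rw [pd, (hasFDerivAt_comp_fiber hB).fderiv]
  simp [fiberForm_single_inl]

lemma pd_congr {ι : Type*} [Fintype ι] [DecidableEq ι] {F H : (ι → ℝ) → ℝ} {x : ι → ℝ}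
    (h : F =ᶠ[𝓝 x] H) (i : ι) : pd i F x = pd i H x := by
  rw [pd, pd, h.fderiv_eq]

/-! ### Inverse and Christoffel symbols of the warped metric -/

/-- The warped product metric `φ(ξ)⁻² g₀ + f(ξ)² τ(ζ)⁻² g̃₀`. -/
abbrev ridgeWarped (ε : Fin n → ℝ) (δ : Fin m → ℝ) (α : Fin n → ℝ) (β : Fin m → ℝ)
    (φ f τ : ℝ → ℝ) : (Fin n ⊕ Fin m → ℝ) → Matrix (Fin n ⊕ Fin m) (Fin n ⊕ Fin m) ℝ :=
  warped (conformal (fun x => φ (α ⬝ᵥ x)) (semiEuclidean ε)) (fun x => f (α ⬝ᵥ x))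
    (conformal (fun y => τ (β ⬝ᵥ y)) (semiEuclidean δ))

section Metric

variable {ε : Fin n → ℝ} {δ : Fin m → ℝ} {α : Fin n → ℝ} {β : Fin m → ℝ} {φ f τ : ℝ → ℝ}
  {p : Fin n ⊕ Fin m → ℝ}

lemma ridgeWarped_inl_inl (i j : Fin n) : ridgeWarped ε δ α β φ f τ p (Sum.inl i) (Sum.inl j)
    = (φ (α ⬝ᵥ toBase p) ^ 2)⁻¹ * (if i = j then ε i else 0) := by
  simp [warped, conformal, semiEuclidean, Matrix.diagonal_apply]

lemma ridgeWarped_inr_inr (i j : Fin m) : ridgeWarped ε δ α β φ f τ p (Sum.inr i) (Sum.inr j)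
    = f (α ⬝ᵥ toBase p) ^ 2 * ((τ (β ⬝ᵥ toFiber p) ^ 2)⁻¹ * (if i = j then δ i else 0)) := by
  simp [warped, conformal, semiEuclidean, Matrix.diagonal_apply]

lemma ridgeWarped_inl_inr (i : Fin n) (j : Fin m) :
    ridgeWarped ε δ α β φ f τ p (Sum.inl i) (Sum.inr j) = 0 := by
  simp [warped]

lemma ridgeWarped_inr_inl (i : Fin m) (j : Fin n) :
    ridgeWarped ε δ α β φ f τ p (Sum.inr i) (Sum.inl j) = 0 := by
  simp [warped]

lemma ridgeWarped_inv (hε : ∀ i, ε i * ε i = 1) (hδ : ∀ j, δ j * δ j = 1)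
    (hφ : φ (α ⬝ᵥ toBase p) ≠ 0) (hf : f (α ⬝ᵥ toBase p) ≠ 0) (hτ : τ (β ⬝ᵥ toFiber p) ≠ 0) :
    (ridgeWarped ε δ α β φ f τ p)⁻¹ = Matrix.diagonal (Sum.elim
      (fun i => φ (α ⬝ᵥ toBase p) ^ 2 * ε i)
      (fun j => (f (α ⬝ᵥ toBase p) ^ 2)⁻¹ * (τ (β ⬝ᵥ toFiber p) ^ 2 * δ j))) := by
  have h : ridgeWarped ε δ α β φ f τ p = Matrix.diagonal (Sum.elim
      (fun i => (φ (α ⬝ᵥ toBase p) ^ 2)⁻¹ * ε i)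
      (fun j => f (α ⬝ᵥ toBase p) ^ 2 * ((τ (β ⬝ᵥ toFiber p) ^ 2)⁻¹ * δ j))) := by
    ext (i | i) (j | j)
    · rw [ridgeWarped_inl_inl]; simp [Matrix.diagonal_apply]
    · rw [ridgeWarped_inl_inr]; simp
    · rw [ridgeWarped_inr_inl]; simp
    · rw [ridgeWarped_inr_inr]; simp [Matrix.diagonal_apply]
  rw [h]
  refine Matrix.inv_eq_right_inv ?_
  rw [Matrix.diagonal_mul_diagonal, ← Matrix.diagonal_one]
  congr 1
  funext a
  rcases a with i | j
  · simp only [Sum.elim_inl]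
    field_simp
    rw [pow_two, hε]
  · simp only [Sum.elim_inr]
    field_simp
    rw [pow_two, hδ]

lemma christoffel_symm {ι : Type*} [Fintype ι] [DecidableEq ι] {G : (ι → ℝ) → Matrix ι ι ℝ}
    (x : ι → ℝ) (hG : ∀ i j y, G y i j = G y j i) (k i j : ι) :
    christoffel G k i j x = christoffel G k j i x := by
  have h : (fun y => G y i j) = fun y => G y j i := funext (hG i j)
  simp only [christoffel]
  rw [h]
  congr 1
  refine Finset.sum_congr rfl fun l _ => ?_
  ring

lemma ridgeWarped_symm (a b : Fin n ⊕ Fin m) (q : Fin n ⊕ Fin m → ℝ) :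
    ridgeWarped ε δ α β φ f τ q a b = ridgeWarped ε δ α β φ f τ q b a := by
  rcases a with i | i <;> rcases b with j | j
  · rw [ridgeWarped_inl_inl, ridgeWarped_inl_inl]
    by_cases h : i = j
    · subst h; rfl
    · simp [h, Ne.symm h]
  · rw [ridgeWarped_inl_inr, ridgeWarped_inr_inl]
  · rw [ridgeWarped_inl_inr, ridgeWarped_inr_inl]
  · rw [ridgeWarped_inr_inr, ridgeWarped_inr_inr]
    by_cases h : i = j
    · subst h; rfl
    · simp [h, Ne.symm h]

variable (hε : ∀ i, ε i * ε i = 1) (hδ : ∀ j, δ j * δ j = 1)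
  (hφ : φ (α ⬝ᵥ toBase p) ≠ 0) (hf : f (α ⬝ᵥ toBase p) ≠ 0) (hτ : τ (β ⬝ᵥ toFiber p) ≠ 0)
  (dφ : DifferentiableAt ℝ φ (α ⬝ᵥ toBase p)) (df : DifferentiableAt ℝ f (α ⬝ᵥ toBase p))
  (dτ : DifferentiableAt ℝ τ (β ⬝ᵥ toFiber p))

lemma pd_const_zero {ι : Type*} [Fintype ι] [DecidableEq ι] (i : ι) (x : ι → ℝ) :
    pd i (fun _ => (0 : ℝ)) x = 0 := by
  simp [pd]

/-- The factor `ψ⁻²` is kept apart from the logarithmic derivative so that it cancels against the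
inverse metric. -/
lemma hasDerivAt_inv_sq {ψ : ℝ → ℝ} {s : ℝ} (hψ : ψ s ≠ 0) (dψ : DifferentiableAt ℝ ψ s) :
    HasDerivAt (fun t => (ψ t ^ 2)⁻¹) (2 * (-deriv ψ s / ψ s) * (ψ s ^ 2)⁻¹) s := by
  refine ((dψ.hasDerivAt.fun_pow 2).fun_inv (pow_ne_zero 2 hψ)).congr_deriv ?_
  field_simp
  norm_num
  ring

include hφ dφ in
lemma pd_inl_ridgeWarped_inl_inl (k i j : Fin n) :
    pd (Sum.inl k) (fun q => ridgeWarped ε δ α β φ f τ q (Sum.inl i) (Sum.inl j)) p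
      = 2 * (-deriv φ (α ⬝ᵥ toBase p) / φ (α ⬝ᵥ toBase p)) * (φ (α ⬝ᵥ toBase p) ^ 2)⁻¹ * α k
        * (if i = j then ε i else 0) := by
  simp only [ridgeWarped_inl_inl]
  exact pd_inl_comp_base_mul (hasDerivAt_inv_sq hφ dφ) _ k

include hφ dφ in
lemma pd_inr_ridgeWarped_inl_inl (k : Fin m) (i j : Fin n) :
    pd (Sum.inr k) (fun q => ridgeWarped ε δ α β φ f τ q (Sum.inl i) (Sum.inl j)) p = 0 := by
  simp only [ridgeWarped_inl_inl]
  exact pd_inr_comp_base_mul (hasDerivAt_inv_sq hφ dφ) _ k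

include hτ df dτ in
lemma pd_inl_ridgeWarped_inr_inr (k : Fin n) (i j : Fin m) :
    pd (Sum.inl k) (fun q => ridgeWarped ε δ α β φ f τ q (Sum.inr i) (Sum.inr j)) p
      = 2 * f (α ⬝ᵥ toBase p) * deriv f (α ⬝ᵥ toBase p) * α k
        * ((τ (β ⬝ᵥ toFiber p) ^ 2)⁻¹ * (if i = j then δ i else 0)) := by
  simp only [ridgeWarped_inr_inr]
  have hA : HasDerivAt (fun s => f s ^ 2) (2 * f (α ⬝ᵥ toBase p) * deriv f (α ⬝ᵥ toBase p))
      (α ⬝ᵥ toBase p) := by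
    simpa using df.hasDerivAt.fun_pow 2
  exact pd_inl_comp_base_mul_comp_fiber hA
    ((hasDerivAt_inv_sq hτ dτ).mul_const (if i = j then δ i else 0)) k

include hε hδ hφ hf hτ dφ in
lemma christoffel_inl_inl_inl (k i j : Fin n) :
    christoffel (ridgeWarped ε δ α β φ f τ) (Sum.inl k) (Sum.inl i) (Sum.inl j) p
      = -deriv φ (α ⬝ᵥ toBase p) / φ (α ⬝ᵥ toBase p) * conformalSymbol ε α k i j := by
  simp only [christoffel, ridgeWarped_inv hε hδ hφ hf hτ, Matrix.diagonal_apply, ite_mul, zero_mul,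
    Finset.sum_ite_eq, Finset.mem_univ, if_true, Sum.elim_inl, pd_inl_ridgeWarped_inl_inl hφ dφ]
  unfold conformalSymbol
  have hk := hε k
  have hi := hε i
  have hj := hε j
  -- With `φ²` and `φ⁻²` abstracted to letters of product 1, the rest is polynomial algebra with
  -- Kronecker deltas.
  have hx : φ (α ⬝ᵥ toBase p) ^ 2 * (φ (α ⬝ᵥ toBase p) ^ 2)⁻¹ = 1 :=
    mul_inv_cancel₀ (pow_ne_zero 2 hφ)
  generalize (φ (α ⬝ᵥ toBase p) ^ 2)⁻¹ = y at *
  generalize -deriv φ (α ⬝ᵥ toBase p) / φ (α ⬝ᵥ toBase p) = a at *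
  generalize φ (α ⬝ᵥ toBase p) ^ 2 = x at *
  have h1 : ε k * (if j = k then ε j else 0) = if j = k then 1 else 0 := by
    split_ifs with h
    · rw [h, hk]
    · simp
  have h2 : ε k * (if i = k then ε i else 0) = if i = k then 1 else 0 := by
    split_ifs with h
    · rw [h, hk]
    · simp
  calc _ = x * y * a * (α i * (ε k * (if j = k then ε j else 0))
        + α j * (ε k * (if i = k then ε i else 0)) - α k * ε k * (if i = j then ε i else 0)) := by
        ring
    _ = _ := by
        rw [hx, h1, h2]
        split_ifs <;> ring

include hε hδ hφ hf hτ dφ in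
lemma christoffel_inr_inl_inl (k : Fin m) (i j : Fin n) :
    christoffel (ridgeWarped ε δ α β φ f τ) (Sum.inr k) (Sum.inl i) (Sum.inl j) p = 0 := by
  simp only [christoffel, ridgeWarped_inv hε hδ hφ hf hτ, Matrix.diagonal_apply, ite_mul, zero_mul,
    Finset.sum_ite_eq, Finset.mem_univ, if_true, pd_inr_ridgeWarped_inl_inl hφ dφ,
    ridgeWarped_inl_inr, pd_const_zero]
  simp

include hε hδ hφ hf hτ dφ in
lemma christoffel_inl_inl_inr (k i : Fin n) (j : Fin m) :
    christoffel (ridgeWarped ε δ α β φ f τ) (Sum.inl k) (Sum.inl i) (Sum.inr j) p = 0 := by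
  simp only [christoffel, ridgeWarped_inv hε hδ hφ hf hτ, Matrix.diagonal_apply, ite_mul, zero_mul,
    Finset.sum_ite_eq, Finset.mem_univ, if_true, pd_inr_ridgeWarped_inl_inl hφ dφ,
    ridgeWarped_inl_inr, ridgeWarped_inr_inl, pd_const_zero]
  simp

include hε hδ hφ hf hτ df dτ in
-- A base derivative of the fiber block only sees `f²`, so the `τ` factor cancels and `f'/f`
-- remains.
lemma christoffel_inr_inl_inr (k : Fin m) (i : Fin n) (j : Fin m) :
    christoffel (ridgeWarped ε δ α β φ f τ) (Sum.inr k) (Sum.inl i) (Sum.inr j) p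
      = deriv f (α ⬝ᵥ toBase p) / f (α ⬝ᵥ toBase p) * (if k = j then α i else 0) := by
  simp only [christoffel, ridgeWarped_inv hε hδ hφ hf hτ, Matrix.diagonal_apply, ite_mul, zero_mul,
    Finset.sum_ite_eq, Finset.mem_univ, if_true, pd_inl_ridgeWarped_inr_inr hτ df dτ,
    ridgeWarped_inl_inr, pd_const_zero, Sum.elim_inr]
  by_cases h : k = j
  · subst h
    have hk := hδ k
    simp only [if_true]
    field_simp
    linear_combination 2 * f (α ⬝ᵥ toBase p) * deriv f (α ⬝ᵥ toBase p) * α i * hk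
  · simp [h, Ne.symm h]

end Metric

/-! ### Ricci tensor and Hessian on base directions -/

/-- On the base directions, the Ricci tensor of the warped metric is a multiple of `α ⊗ α` when
`α` is null. -/
lemma ricci_inl_inl_of_null {ε : Fin n → ℝ} {δ : Fin m → ℝ} {α : Fin n → ℝ} {β : Fin m → ℝ}
    {φ f τ : ℝ → ℝ} {p : Fin n ⊕ Fin m → ℝ} {a b : ℝ → ℝ} {a' b' : ℝ}
    (hε : ∀ i, ε i * ε i = 1) (hnull : semiNormSq ε α = 0)
    (h₁ : ∀ᶠ q in 𝓝 p, ∀ k i j, christoffel (ridgeWarped ε δ α β φ f τ) (Sum.inl k) (Sum.inl i)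
      (Sum.inl j) q = a (α ⬝ᵥ toBase q) * conformalSymbol ε α k i j)
    (h₂ : ∀ᶠ q in 𝓝 p, ∀ k i j, christoffel (ridgeWarped ε δ α β φ f τ) (Sum.inr k) (Sum.inl i)
      (Sum.inl j) q = 0)
    (h₃ : ∀ᶠ q in 𝓝 p, ∀ k i j, christoffel (ridgeWarped ε δ α β φ f τ) (Sum.inl k) (Sum.inl i)
      (Sum.inr j) q = 0)
    (h₄ : ∀ᶠ q in 𝓝 p, ∀ k i j, christoffel (ridgeWarped ε δ α β φ f τ) (Sum.inr k) (Sum.inl i)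
      (Sum.inr j) q = b (α ⬝ᵥ toBase q) * (if k = j then α i else 0))
    (ha : HasDerivAt a a' (α ⬝ᵥ toBase p)) (hb : HasDerivAt b b' (α ⬝ᵥ toBase p)) (i j : Fin n) :
    ricci (ridgeWarped ε δ α β φ f τ) (Sum.inl i) (Sum.inl j) p
      = (2 * a' - (n * a' + m * b')
        + 2 * (n * a (α ⬝ᵥ toBase p) + m * b (α ⬝ᵥ toBase p)) * a (α ⬝ᵥ toBase p)
        - ((n + 2) * a (α ⬝ᵥ toBase p) ^ 2 + m * b (α ⬝ᵥ toBase p) ^ 2)) * (α i * α j) := by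
  set G := ridgeWarped ε δ α β φ f τ with hG
  set s := α ⬝ᵥ toBase p with hs
  -- Symbols with two lower fiber indices never contribute: in `Γᵏₖₗ Γˡᵢⱼ` with `l` in the fiber,
  -- the second factor is zero. The curvature of the fiber is therefore not needed.
  have e₁ := h₁.self_of_nhds
  have e₂ := h₂.self_of_nhds
  have e₃ := h₃.self_of_nhds
  have e₄ := h₄.self_of_nhds
  have sy : ∀ k i j, christoffel G k i j p = christoffel G k j i p :=
    christoffel_symm p ridgeWarped_symm
  have d₁ : ∀ l k i j, pd (Sum.inl l) (christoffel G (Sum.inl k) (Sum.inl i) (Sum.inl j)) p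
      = a' * α l * conformalSymbol ε α k i j := fun l k i j => by
    rw [pd_congr (h₁.mono fun q hq => hq k i j), pd_inl_comp_base_mul ha]
  have d₂ : ∀ l k i j, pd l (christoffel G (Sum.inr k) (Sum.inl i) (Sum.inl j)) p = 0 :=
    fun l k i j => by
      rw [pd_congr (h₂.mono fun q hq => hq k i j), pd_const_zero]
  have d₄ : ∀ l k i, pd (Sum.inl l) (christoffel G (Sum.inr k) (Sum.inl i) (Sum.inr k)) p
      = b' * α l * α i := fun l k i => by
    rw [pd_congr (h₄.mono fun q hq => hq k i k), pd_inl_comp_base_mul hb]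
    simp
  have t1 : ∑ k, pd k (christoffel G k (Sum.inl i) (Sum.inl j)) p = 2 * a' * (α i * α j) := by
    rw [Fintype.sum_sum_type]
    simp only [d₁, d₂, Finset.sum_const_zero, add_zero]
    calc _ = a' * ∑ k, conformalSymbol ε α k i j * α k := by
          rw [Finset.mul_sum]; exact Finset.sum_congr rfl fun k _ => by ring
      _ = _ := by rw [sum_conformalSymbol_mul hnull]; ring
  have t2 : ∑ k, pd (Sum.inl j) (christoffel G k (Sum.inl i) k) p
      = (n * a' + m * b') * (α i * α j) := by
    rw [Fintype.sum_sum_type]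
    simp only [d₁, d₄, ← Finset.mul_sum, sum_conformalSymbol_trace hε]
    simp
    ring
  have tr : ∀ l, ∑ k, christoffel G k k (Sum.inl l) p = (n * a s + m * b s) * α l := by
    intro l
    -- Symmetry moves the base index to the first lower slot, where the formulas apply.
    simp only [fun k => sy k k (Sum.inl l)]
    rw [Fintype.sum_sum_type]
    simp only [e₁, e₄, ← Finset.mul_sum, sum_conformalSymbol_trace hε]
    simp
    ring
  have t3 : ∑ k, ∑ l, christoffel G k k l p * christoffel G l (Sum.inl i) (Sum.inl j) p
      = 2 * (n * a s + m * b s) * a s * (α i * α j) := by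
    rw [Finset.sum_comm, Fintype.sum_sum_type]
    simp only [← Finset.sum_mul, tr, e₂, e₁, mul_zero, Finset.sum_const_zero, add_zero]
    calc _ = (n * a s + m * b s) * a s * ∑ k, conformalSymbol ε α k i j * α k := by
          rw [Finset.mul_sum]; exact Finset.sum_congr rfl fun k _ => by ring
      _ = _ := by rw [sum_conformalSymbol_mul hnull]; ring
  have t4 : ∑ k, ∑ l, christoffel G k (Sum.inl j) l p * christoffel G l (Sum.inl i) k p
      = ((n + 2) * a s ^ 2 + m * b s ^ 2) * (α i * α j) := by
    -- Mixed base-fiber products vanish; the base pairs give the `a²` term and the fiber pairs the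
    -- `b²` term.
    simp only [Fintype.sum_sum_type, e₁, e₂, e₃, e₄, mul_zero, Finset.sum_const_zero, add_zero,
      zero_add]
    have u1 : ∑ k, ∑ l, a s * conformalSymbol ε α k j l * (a s * conformalSymbol ε α l i k)
        = a s ^ 2 * ((n + 2) * (α i * α j)) := by
      rw [← sum_conformalSymbol_mul_conformalSymbol hε hnull, Finset.mul_sum]
      refine Finset.sum_congr rfl fun k _ => ?_
      rw [Finset.mul_sum]
      exact Finset.sum_congr rfl fun l _ => by ring
    rw [u1]
    simp
    ring
  simp only [ricci, Finset.sum_add_distrib, Finset.sum_sub_distrib]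
  rw [t1, t2, t3, t4]
  ring

/-- On the base directions, the Hessian of a function of `α ⬝ᵥ x` is a multiple of `α ⊗ α` when
`α` is null. -/
lemma hess_inl_inl_of_null {ε : Fin n → ℝ} {δ : Fin m → ℝ} {α : Fin n → ℝ} {β : Fin m → ℝ}
    {φ f τ h : ℝ → ℝ} {p : Fin n ⊕ Fin m → ℝ} {c : ℝ} {h'' : ℝ}
    (hnull : semiNormSq ε α = 0)
    (h₁ : ∀ k i j, christoffel (ridgeWarped ε δ α β φ f τ) (Sum.inl k) (Sum.inl i)
      (Sum.inl j) p = c * conformalSymbol ε α k i j)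
    (h₂ : ∀ k i j, christoffel (ridgeWarped ε δ α β φ f τ) (Sum.inr k) (Sum.inl i)
      (Sum.inl j) p = 0)
    (hh : ∀ᶠ q in 𝓝 p, DifferentiableAt ℝ h (α ⬝ᵥ toBase q))
    (hh' : HasDerivAt (deriv h) h'' (α ⬝ᵥ toBase p)) (i j : Fin n) :
    hess (ridgeWarped ε δ α β φ f τ) (fun q => h (α ⬝ᵥ toBase q)) (Sum.inl i) (Sum.inl j) p
      = (h'' - 2 * c * deriv h (α ⬝ᵥ toBase p)) * (α i * α j) := by
  have d : ∀ᶠ q : Fin n ⊕ Fin m → ℝ in 𝓝 p, ∀ k : Fin n,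
      pd (Sum.inl k) (fun q => h (α ⬝ᵥ toBase q)) q = deriv h (α ⬝ᵥ toBase q) * α k := by
    filter_upwards [hh] with q hq k
    simpa using pd_inl_comp_base_mul hq.hasDerivAt 1 k
  rw [hess, pd_congr (d.mono fun q hq => hq j), pd_inl_comp_base_mul hh', Fintype.sum_sum_type]
  simp only [h₁, h₂, d.self_of_nhds, zero_mul, Finset.sum_const_zero, add_zero]
  have : ∑ k, c * conformalSymbol ε α k i j * (deriv h (α ⬝ᵥ toBase p) * α k)
      = c * deriv h (α ⬝ᵥ toBase p) * ∑ k, conformalSymbol ε α k i j * α k := by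
    rw [Finset.mul_sum]; exact Finset.sum_congr rfl fun k _ => by ring
  rw [this, sum_conformalSymbol_mul hnull]
  ring

lemma exists_dotProduct_eq {ι : Type*} [Fintype ι] {α : ι → ℝ} (hα : α ≠ 0) (s : ℝ) :
    ∃ x : ι → ℝ, α ⬝ᵥ x = s := by
  classical
  obtain ⟨i, hi⟩ := Function.ne_iff.mp hα
  exact ⟨Pi.single i (s / α i), by simpa using mul_div_cancel₀ s hi⟩

end GRHS

end

/-! ### The soliton equation at one point -/

theorem mainTheorem7 {n m : ℕ}
    (ε : Fin n → ℝ) (hε : ∀ i, ε i = 1 ∨ ε i = -1)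
    (δ : Fin m → ℝ) (hδ : ∀ j, δ j = 1 ∨ δ j = -1)
    (α : Fin n → ℝ) (hα : α ≠ 0)
    (β : Fin m → ℝ) (hβ : β ≠ 0)
    (I J : Set ℝ) (hI : IsOpen I) (hI' : I.OrdConnected) (hI₀ : I.Nonempty)
    (hJ : IsOpen J) (hJ' : J.OrdConnected) (hJ₀ : J.Nonempty)
    (φ f h τ u : ℝ → ℝ) (lam : ℝ)
    (hφ : ContDiffOn ℝ ∞ φ I) (hφ₀ : ∀ s ∈ I, φ s ≠ 0)
    (hf : ContDiffOn ℝ ∞ f I) (hf₀ : ∀ s ∈ I, 0 < f s)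
    (hh : ContDiffOn ℝ ∞ h I)
    (hτ : ContDiffOn ℝ ∞ τ J) (hτ₀ : ∀ t ∈ J, τ t ≠ 0)
    (hu : ContDiffOn ℝ ∞ u J) (hu₀ : ∃ s ∈ J, ∃ t ∈ J, u s ≠ u t)
    (hsol : GRHS.IsGRHSOn
      {p : Fin n ⊕ Fin m → ℝ | α ⬝ᵥ GRHS.toBase p ∈ I ∧ β ⬝ᵥ GRHS.toFiber p ∈ J}
      (GRHS.warped
        (GRHS.conformal (fun x => φ (α ⬝ᵥ x)) (GRHS.semiEuclidean ε))
        (fun x => f (α ⬝ᵥ x))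
        (GRHS.conformal (fun y => τ (β ⬝ᵥ y)) (GRHS.semiEuclidean δ)))
      (fun p => h (α ⬝ᵥ GRHS.toBase p))
      (fun p => u (β ⬝ᵥ GRHS.toFiber p))
      lam)
    (hnull : GRHS.semiNormSq ε α = 0) :
    lam = 0 := by
  have hε' : ∀ i, ε i * ε i = 1 := fun i => by rcases hε i with h | h <;> simp [h]
  have hδ' : ∀ j, δ j * δ j = 1 := fun j => by rcases hδ j with h | h <;> simp [h]
  obtain ⟨s, hs⟩ := hI₀
  obtain ⟨t, ht⟩ := hJ₀
  obtain ⟨x, hx⟩ := GRHS.exists_dotProduct_eq hα s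
  obtain ⟨y, hy⟩ := GRHS.exists_dotProduct_eq hβ t
  obtain ⟨p, hp⟩ : ∃ p : Fin n ⊕ Fin m → ℝ, p = Sum.elim x y := ⟨_, rfl⟩
  have hpx : α ⬝ᵥ GRHS.toBase p = s := by rw [hp]; exact hx
  have hpy : β ⬝ᵥ GRHS.toFiber p = t := by rw [hp]; exact hy
  have hpU : α ⬝ᵥ GRHS.toBase p ∈ I ∧ β ⬝ᵥ GRHS.toFiber p ∈ J := by rw [hpx, hpy]; exact ⟨hs, ht⟩
  -- Ricci differentiates the Christoffel symbols, so their formulas are needed near `p`, not just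
  -- at `p`.
  have hev : ∀ᶠ q in nhds p, α ⬝ᵥ GRHS.toBase q ∈ I ∧ β ⬝ᵥ GRHS.toFiber q ∈ J :=
    hsol.isOpen.mem_nhds hpU
  have smooth_diff : ∀ {F : ℝ → ℝ} {K : Set ℝ}, IsOpen K → ContDiffOn ℝ ∞ F K →
      ∀ r ∈ K, DifferentiableAt ℝ F r := fun hK hF r hr =>
    (hF.contDiffAt (hK.mem_nhds hr)).differentiableAt (by simp)
  have smooth_deriv : ∀ {F : ℝ → ℝ} {K : Set ℝ}, IsOpen K → ContDiffOn ℝ ∞ F K →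
      ∀ r ∈ K, DifferentiableAt ℝ (deriv F) r := fun hK hF =>
    smooth_diff hK (hF.deriv_of_isOpen hK (by simp))
  have dφ := smooth_diff hI hφ
  have df := smooth_diff hI hf
  have dτ := smooth_diff hJ hτ
  have hf₁ : ∀ r ∈ I, f r ≠ 0 := fun r hr => (hf₀ r hr).ne'
  have h₁ := hev.mono fun q hq => GRHS.christoffel_inl_inl_inl (ε := ε) (δ := δ) (α := α) (β := β)
    hε' hδ' (hφ₀ _ hq.1) (hf₁ _ hq.1) (hτ₀ _ hq.2) (dφ _ hq.1)
  have h₂ := hev.mono fun q hq => GRHS.christoffel_inr_inl_inl (ε := ε) (δ := δ) (α := α) (β := β)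
    hε' hδ' (hφ₀ _ hq.1) (hf₁ _ hq.1) (hτ₀ _ hq.2) (dφ _ hq.1)
  have h₃ := hev.mono fun q hq => GRHS.christoffel_inl_inl_inr (ε := ε) (δ := δ) (α := α) (β := β)
    hε' hδ' (hφ₀ _ hq.1) (hf₁ _ hq.1) (hτ₀ _ hq.2) (dφ _ hq.1)
  have h₄ := hev.mono fun q hq => GRHS.christoffel_inr_inl_inr (ε := ε) (δ := δ) (α := α) (β := β)
    hε' hδ' (hφ₀ _ hq.1) (hf₁ _ hq.1) (hτ₀ _ hq.2) (df _ hq.1) (dτ _ hq.2)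
  have da : DifferentiableAt ℝ (fun r => -deriv φ r / φ r) (α ⬝ᵥ GRHS.toBase p) :=
    (smooth_deriv hI hφ _ hpU.1).fun_neg.fun_div (dφ _ hpU.1) (hφ₀ _ hpU.1)
  have db : DifferentiableAt ℝ (fun r => deriv f r / f r) (α ⬝ᵥ GRHS.toBase p) :=
    (smooth_deriv hI hf _ hpU.1).fun_div (df _ hpU.1) (hf₁ _ hpU.1)
  -- The value of the coefficient is irrelevant; only its independence of `i` and `j` matters.
  obtain ⟨A, hRic⟩ : ∃ A : ℝ, ∀ i j, GRHS.ricci (GRHS.ridgeWarped ε δ α β φ f τ) (Sum.inl i)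
      (Sum.inl j) p = A * (α i * α j) := ⟨_, GRHS.ricci_inl_inl_of_null (a := fun r => -deriv φ r / φ r)
    (b := fun r => deriv f r / f r) hε' hnull h₁ h₂ h₃ h₄ da.hasDerivAt db.hasDerivAt⟩
  obtain ⟨B, hHess⟩ : ∃ B : ℝ, ∀ i j, GRHS.hess (GRHS.ridgeWarped ε δ α β φ f τ)
      (fun q => h (α ⬝ᵥ GRHS.toBase q)) (Sum.inl i) (Sum.inl j) p = B * (α i * α j) :=
    ⟨_, GRHS.hess_inl_inl_of_null (h := h) hnull h₁.self_of_nhds h₂.self_of_nhds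
    (hev.mono fun q hq => smooth_diff hI hh _ hq.1) (smooth_deriv hI hh _ hpU.1).hasDerivAt⟩
  obtain ⟨θ, -, hθ⟩ := hsol.equations
  have heq := fun i j => (hθ p hpU).1 (Sum.inl i) (Sum.inl j)
  obtain ⟨S, hS⟩ : ∃ S : ℝ, ∀ i j, S * (α i * α j)
      = lam * ((φ s ^ 2)⁻¹ * (if i = j then ε i else 0)) := by
    refine ⟨A + B, fun i j => ?_⟩
    have e := heq i j
    rw [hRic, hHess, GRHS.pd_inl_comp_fiber (smooth_diff hJ hu _ hpU.2).hasDerivAt,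
      zero_mul, mul_zero, sub_zero, ← add_mul] at e
    rw [e, ← hpx]
    exact congrArg (lam * ·) (GRHS.ridgeWarped_inl_inl (φ := φ) i j)
  obtain ⟨i, hi⟩ := Function.ne_iff.mp hα
  -- Contraction with the `g₀`-dual of `α`, which the null form `α ⊗ α` annihilates but the metric
  -- does not.
  have hsum : ∑ j, ε j * α j * (S * (α i * α j))
      = ∑ j, ε j * α j * (lam * ((φ s ^ 2)⁻¹ * (if i = j then ε i else 0))) :=
    Finset.sum_congr rfl fun j _ => by rw [hS]
  have hl : ∑ j, ε j * α j * (S * (α i * α j)) = 0 := by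
    have : ∑ j, ε j * α j * (S * (α i * α j)) = S * α i * GRHS.semiNormSq ε α := by
      rw [GRHS.semiNormSq, Finset.mul_sum]
      exact Finset.sum_congr rfl fun j _ => by ring
    rw [this, hnull, mul_zero]
  have hr : ∑ j, ε j * α j * (lam * ((φ s ^ 2)⁻¹ * (if i = j then ε i else 0)))
      = lam * ((φ s ^ 2)⁻¹ * α i) := by
    simp only [mul_ite, mul_zero, Finset.sum_ite_eq, Finset.mem_univ, if_true]
    linear_combination lam * (φ s ^ 2)⁻¹ * α i * hε' i
  rw [hl, hr] at hsum
  have hne : (φ s ^ 2)⁻¹ * α i ≠ 0 := mul_ne_zero (inv_ne_zero (pow_ne_zero 2 (hφ₀ s hs))) hi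
  exact (mul_eq_zero.mp hsum.symm).resolve_right hne
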